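/- Throughout, $\otimes$ denotes the minimal (spatial) tensor product of $C^*$-algebras. A *compact quantum group* is a pair $(\mathsf{A},\Delta)$, where $\mathsf{A}$ is a separable unital $C^*$-algebra and $\Delta:\mathsf{A}\to\mathsf{A}\otimes\mathsf{A}$ is a unital $^*$-homomorphism such that $(\Delta\otimes\mathrm{id})\circ\Delta=(\mathrm{id}\otimes\Delta)\circ\Delta$ and such that the linear spans of $\Delta(\mathsf{A})(\mathsf{A}\otimes 1)$ and of $\Delta(\mathsf{A})(1\otimes\mathsf{A})$ are norm-dense in $\mathsf{A}\otimes\mathsf{A}$. A *morphism* $(\mathsf{A},\Delta_{\mathsf{A}})\to(\mathsf{B},\Delta_{\mathsf{B}})$ is a unital $^*$-homomorphism $\pi:\mathsf{A}\to\mathsf{B}$ with $\Delta_{\mathsf{B}}\circ\pi=(\pi\otimes\pi)\circ\Delta_{\mathsf{A}}$. **Lemma 1.1.** Let $(\mathsf{S}_n,\Delta_n)_{n\in\mathbb{N}}$ be a sequence of compact quantum groups and, for all $n\le m$, let $\pi_{n,m}:\mathsf{S}_n\to\mathsf{S}_m$ be a morphism of compact quantum groups, such that $$\pi_{m,k}\circ\pi_{n,m}=\pi_{n,k}\qquad(n\le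 m\le k).$$ Let $\mathsf{S}_\infty$ be the $C^*$-algebraic inductive limit of this system, with canonical unital $^*$-homomorphisms $\pi_{n,\infty}:\mathsf{S}_n\to\mathsf{S}_\infty$, which satisfy $\pi_{m,\infty}\circ\pi_{n,m}=\pi_{n,\infty}$ for $n\le m$. Then there is a unique unital $^*$-homomorphism $\Delta_\infty:\mathsf{S}_\infty\to\mathsf{S}_\infty\otimes\mathsf{S}_\infty$ such that $\Delta_\infty\circ\pi_{n,\infty}=(\pi_{n,\infty}\otimes\pi_{n,\infty})\circ\Delta_n$ for all $n$, and $(\mathsf{S}_\infty,\Delta_\infty)$ is a compact quantum group. Moreover, for every compact quantum group $(\mathsf{S},\Delta)$ and all morphisms of compact quantum groups $\pi_n:\mathsf{S}_n\to\mathsf{S}$ $(n\in\mathbb{N})$ with $\pi_m\circ\pi_{n,m}=\pi_n$ for all $n\le m$, there is a unique morphism of compact quantum groups $\pi_\infty:\mathsf{S}_\infty\to\mathsf{S}$ such that $\pi_n=\pi_\infty\circ\pi_{n,\infty}$ for all $n\in\mathbb{N}$. -/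

import Mathlib

open scoped TensorProduct

universe u v

noncomputable section

/-! ## Hausdorff completion of a star-algebra with respect to a C*-seminorm -/

/-- A C*-seminorm on a unital complex star-algebra `E`: a seminorm which is submultiplicative and
satisfies the C*-identity. -/
structure CStarSeminorm (E : Type u) [Ring E] [StarRing E] [Algebra ℂ E]
    extends Seminorm ℂ E where
  mul_le' : ∀ x y : E, toFun (x * y) ≤ toFun x * toFun y
  star_mul_self' : ∀ x : E, toFun (star x * x) = toFun x * toFun x

namespace CStarSeminorm

section Completion

variable {E : Type u} [Ring E] [StarRing E] [Algebra ℂ E]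

/-- The algebra `E`, equipped with the topology of the C*-seminorm `p`. -/
def Pre (_p : CStarSeminorm E) : Type u := E

variable (p : CStarSeminorm E)

instance : Ring p.Pre := inferInstanceAs (Ring E)
instance : StarRing p.Pre := inferInstanceAs (StarRing E)
instance : Algebra ℂ p.Pre := inferInstanceAs (Algebra ℂ E)

instance : SeminormedRing p.Pre where
  toRing := inferInstance
  __ := p.toSeminorm.toAddGroupSeminorm.toSeminormedAddCommGroup
  norm_mul_le := p.mul_le'

theorem norm_pre (x : p.Pre) : ‖x‖ = p.toSeminorm x := rfl

instance : NormedAlgebra ℂ p.Pre where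
  norm_smul_le c x := (map_smul_eq_mul p.toSeminorm c x).le

theorem norm_star_mul_self_pre (x : p.Pre) : ‖star x * x‖ = ‖x‖ * ‖x‖ := p.star_mul_self' x

theorem norm_star_pre (x : p.Pre) : ‖star x‖ = ‖x‖ := by
  have key : ∀ y : p.Pre, ‖y‖ ≤ ‖star y‖ := by
    intro y
    by_contra h
    push Not at h
    have h1 := norm_mul_le (star y) y
    rw [norm_star_mul_self_pre] at h1
    have h2 := norm_nonneg (star y)
    nlinarith
  exact le_antisymm (by simpa using key (star x)) (key x)

instance : NormedStarGroup p.Pre where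
  norm_star_le x := (norm_star_pre p x).le

/-- The Hausdorff completion of `E` with respect to the C*-seminorm `p` (elements of seminorm
zero are identified with zero). -/
def Compl : Type u := UniformSpace.Completion p.Pre

instance : NormedRing p.Compl := inferInstanceAs (NormedRing (UniformSpace.Completion p.Pre))
instance : CompleteSpace p.Compl := inferInstanceAs (CompleteSpace (UniformSpace.Completion p.Pre))
instance : Algebra ℂ p.Compl := inferInstanceAs (Algebra ℂ (UniformSpace.Completion p.Pre))

instance : NormedAlgebra ℂ p.Compl where
  norm_smul_le := norm_smul_le (α := ℂ) (β := UniformSpace.Completion p.Pre)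

/-- The canonical map of `E` into its completion. -/
def coe (x : E) : p.Compl := UniformSpace.Completion.coe' (α := p.Pre) x

theorem norm_coe (x : E) : ‖p.coe x‖ = p.toSeminorm x :=
  UniformSpace.Completion.norm_coe (E := p.Pre) x

theorem denseRange_coe : DenseRange p.coe := UniformSpace.Completion.denseRange_coe (α := p.Pre)

theorem induction {P : p.Compl → Prop} (x : p.Compl) (hc : IsClosed {x | P x})
    (h : ∀ x : E, P (p.coe x)) : P x :=
  UniformSpace.Completion.induction_on (α := p.Pre) x hc h

theorem coe_add (x y : E) : p.coe (x + y) = p.coe x + p.coe y :=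
  UniformSpace.Completion.coe_add (α := p.Pre) x y

theorem coe_mul (x y : E) : p.coe (x * y) = p.coe x * p.coe y :=
  UniformSpace.Completion.coe_mul (α := p.Pre) x y

theorem coe_smul (c : ℂ) (x : E) : p.coe (c • x) = c • p.coe x :=
  UniformSpace.Completion.coe_smul (X := p.Pre) c x

/-- The involution of the completion is the continuous extension of the involution of `E`. -/
instance : Star p.Compl where
  star := UniformSpace.Completion.map (α := p.Pre) (β := p.Pre) star

theorem uniformContinuous_star_pre : UniformContinuous (star : p.Pre → p.Pre) :=
  (starNormedAddGroupHom : NormedAddGroupHom p.Pre p.Pre).uniformContinuous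

theorem coe_star (x : E) : p.coe (star x) = star (p.coe x) :=
  (UniformSpace.Completion.map_coe (uniformContinuous_star_pre p) x).symm

theorem continuous_star_compl : Continuous (star : p.Compl → p.Compl) :=
  UniformSpace.Completion.continuous_map

instance : StarRing p.Compl where
  star_involutive x := by
    refine p.induction (P := fun x ↦ star (star x) = x) x ?_ fun x ↦ ?_
    · exact isClosed_eq ((continuous_star_compl p).comp (continuous_star_compl p)) continuous_id
    · rw [← coe_star, ← coe_star, star_star]
  star_mul x y := by
    have hs := continuous_star_compl p
    refine p.induction (P := fun x ↦ star (x * y) = star y * star x) x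
      (isClosed_eq (by fun_prop) (by fun_prop)) fun x ↦ ?_
    refine p.induction (P := fun y ↦ star (p.coe x * y) = star y * star (p.coe x)) y
      (isClosed_eq (by fun_prop) (by fun_prop)) fun y ↦ ?_
    simp only [← coe_mul, ← coe_star, star_mul]
  star_add x y := by
    have hs := continuous_star_compl p
    refine p.induction (P := fun x ↦ star (x + y) = star x + star y) x
      (isClosed_eq (by fun_prop) (by fun_prop)) fun x ↦ ?_
    refine p.induction (P := fun y ↦ star (p.coe x + y) = star (p.coe x) + star y) y
      (isClosed_eq (by fun_prop) (by fun_prop)) fun y ↦ ?_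
    simp only [← coe_add, ← coe_star, star_add]

theorem norm_mul_self_le_compl (x : p.Compl) : ‖x‖ * ‖x‖ ≤ ‖star x * x‖ := by
  have hs := continuous_star_compl p
  refine p.induction (P := fun x ↦ ‖x‖ * ‖x‖ ≤ ‖star x * x‖) x
    (isClosed_le (by fun_prop) (by fun_prop)) fun x ↦ ?_
  rw [← coe_star, ← coe_mul, norm_coe, norm_coe]
  exact (p.star_mul_self' x).ge

theorem star_smul_compl [StarModule ℂ E] (c : ℂ) (x : p.Compl) : star (c • x) = star c • star x := by
  have hs := continuous_star_compl p
  refine p.induction (P := fun x ↦ star (c • x) = star c • star x) x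
    (isClosed_eq (hs.comp (continuous_const_smul c)) (hs.const_smul (star c))) fun x ↦ ?_
  rw [← coe_smul, ← coe_star, ← coe_star, ← coe_smul, star_smul]

instance : CStarRing p.Compl where
  norm_mul_self_le := norm_mul_self_le_compl p

instance [StarModule ℂ E] : StarModule ℂ p.Compl where
  star_smul := star_smul_compl p

instance [StarModule ℂ E] : CStarAlgebra p.Compl where

/-- The canonical unital star-homomorphism of `E` into its completion. -/
def of : E →⋆ₐ[ℂ] p.Compl where
  toFun := p.coe
  map_one' := UniformSpace.Completion.coe_one (α := p.Pre)
  map_mul' := p.coe_mul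
  map_zero' := UniformSpace.Completion.coe_zero (α := p.Pre)
  map_add' := p.coe_add
  commutes' c := by
    rw [Algebra.algebraMap_eq_smul_one, Algebra.algebraMap_eq_smul_one, p.coe_smul]
    exact congrArg (c • ·) (UniformSpace.Completion.coe_one (α := p.Pre))
  map_star' := p.coe_star

theorem norm_of (x : E) : ‖p.of x‖ = p.toSeminorm x := p.norm_coe x

theorem denseRange_of : DenseRange p.of := p.denseRange_coe

/-- A unital star-homomorphism from `E` to a C*-algebra which is contractive for `p` extends
by continuity to the completion. -/
def lift {B : Type v} [CStarAlgebra B] (f : E →⋆ₐ[ℂ] B) (hf : ∀ x, ‖f x‖ ≤ p.toSeminorm x) :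
    p.Compl →⋆ₐ[ℂ] B :=
  let g : p.Pre →+* B := (f : E →+* B)
  have hg : Continuous g :=
    AddMonoidHomClass.continuous_of_bound g 1 fun x ↦ (hf x).trans (one_mul _).ge
  let F : p.Compl →+* B := UniformSpace.Completion.extensionHom g hg
  have hF : Continuous F := UniformSpace.Completion.continuous_extension
  have hFc : ∀ x : E, F (p.coe x) = f x := UniformSpace.Completion.extensionHom_coe g hg
  { F with
    commutes' := fun c ↦ by
      have h : algebraMap ℂ p.Compl c = p.coe (algebraMap ℂ E c) := (p.of.commutes' c).symm
      change F (algebraMap ℂ p.Compl c) = _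
      rw [h, hFc]
      exact AlgHomClass.commutes f c
    map_star' := fun x ↦ by
      have hs := continuous_star_compl p
      change F (star x) = star (F x)
      refine p.induction (P := fun x ↦ F (star x) = star (F x)) x
        (isClosed_eq (by fun_prop) (by fun_prop)) fun x ↦ ?_
      rw [← coe_star, hFc, hFc, map_star] }

@[simp] theorem lift_of {B : Type v} [CStarAlgebra B] (f : E →⋆ₐ[ℂ] B)
    (hf : ∀ x, ‖f x‖ ≤ p.toSeminorm x) (x : E) : p.lift f hf (p.of x) = f x :=
  let g : p.Pre →+* B := (f : E →+* B)
  have hg : Continuous g :=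
    AddMonoidHomClass.continuous_of_bound g 1 fun x ↦ (hf x).trans (one_mul _).ge
  UniformSpace.Completion.extensionHom_coe g hg x

end Completion

end CStarSeminorm

/-! ## The minimal (spatial) tensor product of unital C*-algebras -/

/-- A unital star-representation of `A` by bounded operators on a complex Hilbert space. -/
structure HilbertRep (A : Type u) [CStarAlgebra A] where
  space : Type u
  [normedSpace : NormedAddCommGroup space]
  [innerSpace : InnerProductSpace ℂ space]
  [completeSpace : CompleteSpace space]
  rep : A →⋆ₐ[ℂ] (space →L[ℂ] space)

namespace HilbertRep

attribute [instance] normedSpace innerSpace completeSpace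

variable {A B : Type u} [CStarAlgebra A] [CStarAlgebra B]

/-- The tensor product `π ⊗ σ` of two representations, acting by bounded operators on the
algebraic tensor product of the two Hilbert spaces, with its canonical inner product:
`(π ⊗ σ)(a ⊗ b) = π a ⊗ σ b`. -/
def tensor (π : HilbertRep A) (σ : HilbertRep B) :
    A ⊗[ℂ] B →ₐ[ℂ] (π.space ⊗[ℂ] σ.space →L[ℂ] π.space ⊗[ℂ] σ.space) :=
  Algebra.TensorProduct.lift
    (AlgHom.ofLinearMap
      { toFun := fun a ↦ (π.rep a).rTensor σ.space
        map_add' := by simp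
        map_smul' := by simp }
      (by simp) (by simp [ContinuousLinearMap.rTensor_mul]))
    (AlgHom.ofLinearMap
      { toFun := fun b ↦ (σ.rep b).lTensor π.space
        map_add' := by simp
        map_smul' := by simp }
      (by simp) (by simp [ContinuousLinearMap.lTensor_mul]))
    (fun a b ↦ by
      change (π.rep a).rTensor σ.space ∘L (σ.rep b).lTensor π.space
        = (σ.rep b).lTensor π.space ∘L (π.rep a).rTensor σ.space
      simp)

theorem tensor_tmul (π : HilbertRep A) (σ : HilbertRep B) (a : A) (b : B) :
    π.tensor σ (a ⊗ₜ b) = TensorProduct.mapL (π.rep a) (σ.rep b) := by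
  rw [tensor, Algebra.TensorProduct.lift_tmul]
  change (π.rep a).rTensor σ.space ∘L (σ.rep b).lTensor π.space = _
  simp

theorem inner_tensor_star (π : HilbertRep A) (σ : HilbertRep B) (x : A ⊗[ℂ] B)
    (ξ η : π.space ⊗[ℂ] σ.space) :
    inner ℂ (π.tensor σ (star x) ξ) η = inner ℂ ξ (π.tensor σ x η) := by
  induction x with
  | zero => simp
  | add x y hx hy => simp [inner_add_left, inner_add_right, hx, hy]
  | tmul a b =>
    rw [TensorProduct.star_tmul, tensor_tmul, tensor_tmul]
    induction ξ with
    | zero => simp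
    | add ξ ξ' h h' => simp only [map_add, inner_add_left, h, h']
    | tmul s t =>
      induction η with
      | zero => simp
      | add η η' h h' => simp only [map_add, inner_add_right, h, h']
      | tmul s' t' =>
        simp only [TensorProduct.mapL_tmul, TensorProduct.inner_tmul, map_star,
          ContinuousLinearMap.star_eq_adjoint, ContinuousLinearMap.adjoint_inner_left]

theorem norm_tensor_star_mul_self (π : HilbertRep A) (σ : HilbertRep B) (x : A ⊗[ℂ] B) :
    ‖π.tensor σ (star x * x)‖ = ‖π.tensor σ x‖ * ‖π.tensor σ x‖ := by
  have key : ∀ y : A ⊗[ℂ] B, ‖π.tensor σ y‖ * ‖π.tensor σ y‖ ≤ ‖π.tensor σ (star y * y)‖ := by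
    intro y
    set C := ‖π.tensor σ (star y * y)‖ with hC
    have hC0 : 0 ≤ C := norm_nonneg (π.tensor σ (star y * y))
    have h : ‖π.tensor σ y‖ ≤ √C := by
      refine ContinuousLinearMap.opNorm_le_bound _ (Real.sqrt_nonneg _) fun ξ ↦ ?_
      refine abs_le_of_sq_le_sq' ?_ (by positivity) |>.2
      rw [mul_pow, Real.sq_sqrt hC0]
      have h1 : ((‖π.tensor σ y ξ‖ ^ 2 : ℝ) : ℂ)
          = inner ℂ (π.tensor σ (star y * y) ξ) ξ := by
        rw [map_mul, mul_apply_eq_comp, inner_tensor_star,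
          inner_self_eq_norm_sq_to_K (𝕜 := ℂ) (π.tensor σ y ξ)]
        norm_cast
      calc ‖π.tensor σ y ξ‖ ^ 2 = ‖((‖π.tensor σ y ξ‖ ^ 2 : ℝ) : ℂ)‖ := by simp
        _ ≤ ‖π.tensor σ (star y * y) ξ‖ * ‖ξ‖ := by
          rw [h1]; exact norm_inner_le_norm (𝕜 := ℂ) (π.tensor σ (star y * y) ξ) ξ
        _ ≤ (C * ‖ξ‖) * ‖ξ‖ := by gcongr; exact ContinuousLinearMap.le_opNorm _ _
        _ = C * ‖ξ‖ ^ 2 := by ring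
    calc _ ≤ √C * √C := by gcongr
      _ = C := Real.mul_self_sqrt hC0
  have hle : ∀ y : A ⊗[ℂ] B, ‖π.tensor σ y‖ ≤ ‖π.tensor σ (star y)‖ := by
    intro y
    by_contra h
    push Not at h
    have h1 := key y
    have h2 : ‖π.tensor σ (star y * y)‖ ≤ ‖π.tensor σ (star y)‖ * ‖π.tensor σ y‖ := by
      rw [map_mul]; exact norm_mul_le (π.tensor σ (star y)) (π.tensor σ y)
    have h3 := norm_nonneg (π.tensor σ (star y))
    nlinarith
  refine le_antisymm ?_ (key x)
  rw [map_mul]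
  refine (norm_mul_le (π.tensor σ (star x)) (π.tensor σ x)).trans ?_
  refine mul_le_mul_of_nonneg_right ?_ (norm_nonneg (π.tensor σ x))
  simpa using hle (star x)

/-- The pull-back of a representation along a unital star-homomorphism. -/
def comp {A' : Type u} [CStarAlgebra A'] (π : HilbertRep A') (f : A →⋆ₐ[ℂ] A') :
    HilbertRep A where
  space := π.space
  rep := π.rep.comp f

end HilbertRep

/-- The spatial norm on the algebraic tensor product `A ⊗ B`: the supremum of the operator norms
`‖(π ⊗ σ)(x)‖` over all representations `π` of `A` and `σ` of `B` on Hilbert spaces. (The supremum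
is attained at every pair of faithful representations.) -/
def spatialNorm (A B : Type u) [CStarAlgebra A] [CStarAlgebra B] (x : A ⊗[ℂ] B) : ℝ :=
  ⨆ p : HilbertRep A × HilbertRep B, ‖p.1.tensor p.2 x‖

section SpatialNorm

variable {A B A' B' : Type u} [CStarAlgebra A] [CStarAlgebra B] [CStarAlgebra A'] [CStarAlgebra B']

theorem norm_rep_le (π : HilbertRep A) (a : A) : ‖π.rep a‖ ≤ ‖a‖ :=
  NonUnitalStarAlgHom.norm_apply_le π.rep a

theorem bddAbove_spatialNorm (x : A ⊗[ℂ] B) :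
    BddAbove (Set.range fun p : HilbertRep A × HilbertRep B ↦ ‖p.1.tensor p.2 x‖) := by
  induction x with
  | zero => exact ⟨0, by rintro _ ⟨p, rfl⟩; dsimp only; rw [map_zero]; exact ContinuousLinearMap.opNorm_zero.le⟩
  | tmul a b =>
    refine ⟨‖a‖ * ‖b‖, ?_⟩
    rintro _ ⟨p, rfl⟩
    simp only [HilbertRep.tensor_tmul]
    refine (TensorProduct.norm_mapL_le _ _).trans ?_
    gcongr <;> exact norm_rep_le _ _
  | add x y hx hy =>
    obtain ⟨C, hC⟩ := hx
    obtain ⟨D, hD⟩ := hy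
    refine ⟨C + D, ?_⟩
    rintro _ ⟨p, rfl⟩
    dsimp only
    rw [map_add]
    exact (norm_add_le (p.1.tensor p.2 x) (p.1.tensor p.2 y)).trans
      (add_le_add (hC (Set.mem_range_self p)) (hD (Set.mem_range_self p)))

theorem norm_tensor_le_spatialNorm (π : HilbertRep A) (σ : HilbertRep B) (x : A ⊗[ℂ] B) :
    ‖π.tensor σ x‖ ≤ spatialNorm A B x :=
  le_ciSup (bddAbove_spatialNorm x) (π, σ)

theorem spatialNorm_nonneg (x : A ⊗[ℂ] B) : 0 ≤ spatialNorm A B x :=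
  Real.iSup_nonneg fun p ↦ norm_nonneg (p.1.tensor p.2 x)

theorem spatialNorm_le {x : A ⊗[ℂ] B} {C : ℝ} (hC : 0 ≤ C)
    (h : ∀ (π : HilbertRep A) (σ : HilbertRep B), ‖π.tensor σ x‖ ≤ C) : spatialNorm A B x ≤ C :=
  Real.iSup_le (fun p ↦ h p.1 p.2) hC

theorem norm_smul_operator {V : Type u} [NormedAddCommGroup V] [InnerProductSpace ℂ V] (c : ℂ)
    (T : V →L[ℂ] V) : ‖c • T‖ = ‖c‖ * ‖T‖ := norm_smul c T

variable (A B) in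
/-- The spatial norm is a C*-seminorm on the algebraic tensor product. -/
def spatialSeminorm : CStarSeminorm (A ⊗[ℂ] B) where
  toSeminorm := Seminorm.of (spatialNorm A B)
    (fun x y ↦ spatialNorm_le (add_nonneg (spatialNorm_nonneg x) (spatialNorm_nonneg y))
      fun π σ ↦ by
        rw [map_add]
        exact (norm_add_le (π.tensor σ x) (π.tensor σ y)).trans
          (add_le_add (norm_tensor_le_spatialNorm π σ x) (norm_tensor_le_spatialNorm π σ y)))
    (fun c x ↦ by
      rw [spatialNorm, spatialNorm, Real.mul_iSup_of_nonneg (norm_nonneg c)]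
      exact iSup_congr fun q ↦ by
        rw [map_smul]
        exact norm_smul_operator c (q.1.tensor q.2 x))
  mul_le' x y := spatialNorm_le (mul_nonneg (spatialNorm_nonneg x) (spatialNorm_nonneg y))
    fun π σ ↦ by
      rw [map_mul]
      exact (norm_mul_le (π.tensor σ x) (π.tensor σ y)).trans
        (mul_le_mul (norm_tensor_le_spatialNorm π σ x) (norm_tensor_le_spatialNorm π σ y)
          (norm_nonneg (π.tensor σ y)) (spatialNorm_nonneg x))
  star_mul_self' x := by
    change spatialNorm A B (star x * x) = spatialNorm A B x * spatialNorm A B x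
    refine le_antisymm ?_ ?_
    · refine spatialNorm_le (mul_self_nonneg _) fun π σ ↦ ?_
      rw [HilbertRep.norm_tensor_star_mul_self]
      exact mul_self_le_mul_self (norm_nonneg (π.tensor σ x)) (norm_tensor_le_spatialNorm π σ x)
    · have h : spatialNorm A B x ≤ √(spatialNorm A B (star x * x)) := by
        refine spatialNorm_le (Real.sqrt_nonneg _) fun π σ ↦ Real.le_sqrt_of_sq_le ?_
        rw [sq, ← HilbertRep.norm_tensor_star_mul_self]
        exact norm_tensor_le_spatialNorm π σ _
      calc _ ≤ √(spatialNorm A B (star x * x)) * √(spatialNorm A B (star x * x)) :=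
            mul_self_le_mul_self (spatialNorm_nonneg x) h
        _ = _ := Real.mul_self_sqrt (spatialNorm_nonneg _)

theorem spatialSeminorm_apply (x : A ⊗[ℂ] B) :
    (spatialSeminorm A B).toSeminorm x = spatialNorm A B x := rfl

variable (A B) in
/-- The minimal (spatial) tensor product of the unital C*-algebras `A` and `B`: the completion of
their algebraic tensor product in the spatial norm. -/
abbrev MinTensor : Type u := (spatialSeminorm A B).Compl

/-- The algebraic tensor product `f ⊙ g` of two unital star-homomorphisms. -/
def algTensorMap {A A' B B' : Type u} [Ring A] [StarRing A] [Algebra ℂ A] [StarModule ℂ A]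
    [Ring B] [StarRing B] [Algebra ℂ B] [StarModule ℂ B]
    [Ring A'] [StarRing A'] [Algebra ℂ A'] [StarModule ℂ A']
    [Ring B'] [StarRing B'] [Algebra ℂ B'] [StarModule ℂ B']
    (f : A →⋆ₐ[ℂ] A') (g : B →⋆ₐ[ℂ] B') : A ⊗[ℂ] B →⋆ₐ[ℂ] A' ⊗[ℂ] B' where
  toAlgHom := Algebra.TensorProduct.map f.toAlgHom g.toAlgHom
  map_star' x := by
    change Algebra.TensorProduct.map f.toAlgHom g.toAlgHom (star x)
      = star (Algebra.TensorProduct.map f.toAlgHom g.toAlgHom x)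
    induction x with
    | zero => simp
    | add x y hx hy => simp only [star_add, map_add, hx, hy]
    | tmul a b =>
      simp only [TensorProduct.star_tmul, Algebra.TensorProduct.map_tmul]
      exact congrArg₂ _ (map_star f a) (map_star g b)

@[simp] theorem algTensorMap_tmul {A A' B B' : Type u}
    [Ring A] [StarRing A] [Algebra ℂ A] [StarModule ℂ A]
    [Ring B] [StarRing B] [Algebra ℂ B] [StarModule ℂ B]
    [Ring A'] [StarRing A'] [Algebra ℂ A'] [StarModule ℂ A']
    [Ring B'] [StarRing B'] [Algebra ℂ B'] [StarModule ℂ B'] (f : A →⋆ₐ[ℂ] A') (g : B →⋆ₐ[ℂ] B') (a : A) (b : B) :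
    algTensorMap f g (a ⊗ₜ b) = f a ⊗ₜ g b := rfl

theorem tensor_algTensorMap (f : A →⋆ₐ[ℂ] A') (g : B →⋆ₐ[ℂ] B') (π : HilbertRep A')
    (σ : HilbertRep B') (x : A ⊗[ℂ] B) :
    π.tensor σ (algTensorMap f g x) = (π.comp f).tensor (σ.comp g) x := by
  induction x with
  | zero => simp only [map_zero]; rfl
  | add x y hx hy => simp only [map_add, hx, hy]; rfl
  | tmul a b => rw [algTensorMap_tmul, HilbertRep.tensor_tmul, HilbertRep.tensor_tmul]; rfl

theorem spatialNorm_algTensorMap_le (f : A →⋆ₐ[ℂ] A') (g : B →⋆ₐ[ℂ] B') (x : A ⊗[ℂ] B) :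
    spatialNorm A' B' (algTensorMap f g x) ≤ spatialNorm A B x :=
  spatialNorm_le (spatialNorm_nonneg x) fun π σ ↦ by
    rw [tensor_algTensorMap]
    exact norm_tensor_le_spatialNorm (π.comp f) (σ.comp g) x

namespace MinTensor

/-- The elementary tensor `a ⊗ b` in the minimal tensor product. -/
def tmul (a : A) (b : B) : MinTensor A B := (spatialSeminorm A B).of (a ⊗ₜ[ℂ] b)

/-- The tensor product `f ⊗ g` of two unital star-homomorphisms, as a unital star-homomorphism
between minimal tensor products: the continuous extension of `f ⊙ g`. -/
def map (f : A →⋆ₐ[ℂ] A') (g : B →⋆ₐ[ℂ] B') : MinTensor A B →⋆ₐ[ℂ] MinTensor A' B' :=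
  (spatialSeminorm A B).lift ((spatialSeminorm A' B').of.comp (algTensorMap f g)) fun x ↦ by
    rw [StarAlgHom.comp_apply, CStarSeminorm.norm_of]
    exact spatialNorm_algTensorMap_le f g x

@[simp] theorem map_tmul (f : A →⋆ₐ[ℂ] A') (g : B →⋆ₐ[ℂ] B') (a : A) (b : B) :
    map f g (tmul a b) = tmul (f a) (g b) := by
  simp [map, tmul]

variable {C : Type u} [CStarAlgebra C]

variable (A B C) in
/-- The dense embedding of the algebraic triple tensor product in `(A ⊗ B) ⊗ C`. -/
def ofLeft : (A ⊗[ℂ] B) ⊗[ℂ] C →⋆ₐ[ℂ] MinTensor (MinTensor A B) C :=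
  (spatialSeminorm (MinTensor A B) C).of.comp
    (algTensorMap (spatialSeminorm A B).of (StarAlgHom.id ℂ C))

variable (A B C) in
/-- The dense embedding of the algebraic triple tensor product in `A ⊗ (B ⊗ C)`. -/
def ofRight : A ⊗[ℂ] (B ⊗[ℂ] C) →⋆ₐ[ℂ] MinTensor A (MinTensor B C) :=
  (spatialSeminorm A (MinTensor B C)).of.comp
    (algTensorMap (StarAlgHom.id ℂ A) (spatialSeminorm B C).of)

/-- `AssocRel x y` says that `x ∈ (A ⊗ B) ⊗ C` and `y ∈ A ⊗ (B ⊗ C)` are the same element of the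
triple minimal tensor product, i.e. that they correspond under the canonical isomorphism
`(A ⊗ B) ⊗ C ≅ A ⊗ (B ⊗ C)`. This isomorphism is the continuous extension of the algebraic
associator `(a ⊗ b) ⊗ c ↦ a ⊗ (b ⊗ c)`, which is isometric between dense subalgebras; so its graph
is the closure of the graph of the algebraic associator. -/
def AssocRel (x : MinTensor (MinTensor A B) C) (y : MinTensor A (MinTensor B C)) : Prop :=
  (x, y) ∈ closure (Set.range fun t : (A ⊗[ℂ] B) ⊗[ℂ] C ↦
    (ofLeft A B C t, ofRight A B C (TensorProduct.assoc ℂ A B C t)))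

end MinTensor

end SpatialNorm

/-! ## Compact quantum groups -/

/-- `(A, Δ)` is a compact quantum group: `A` is a separable unital C*-algebra and
`Δ : A → A ⊗ A` is a coassociative unital star-homomorphism for which the linear spans of
`Δ(A)(A ⊗ 1)` and of `Δ(A)(1 ⊗ A)` are norm-dense in `A ⊗ A`. -/
structure IsCompactQuantumGroup {A : Type u} [CStarAlgebra A]
    (Δ : A →⋆ₐ[ℂ] MinTensor A A) : Prop where
  separable : TopologicalSpace.SeparableSpace A
  coassoc : ∀ a : A, MinTensor.AssocRel
    (MinTensor.map Δ (StarAlgHom.id ℂ A) (Δ a)) (MinTensor.map (StarAlgHom.id ℂ A) Δ (Δ a))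
  cancel_left : Dense (Submodule.span ℂ
    {x : MinTensor A A | ∃ a b : A, x = Δ a * MinTensor.tmul b 1} : Set (MinTensor A A))
  cancel_right : Dense (Submodule.span ℂ
    {x : MinTensor A A | ∃ a b : A, x = Δ a * MinTensor.tmul 1 b} : Set (MinTensor A A))

/-- The unital star-homomorphism `π : A → B` is a morphism of compact quantum groups
`(A, ΔA) → (B, ΔB)`: it intertwines the coproducts, `ΔB ∘ π = (π ⊗ π) ∘ ΔA`. -/
def IsCQGMorphism {A B : Type u} [CStarAlgebra A] [CStarAlgebra B]
    (ΔA : A →⋆ₐ[ℂ] MinTensor A A) (ΔB : B →⋆ₐ[ℂ] MinTensor B B) (π : A →⋆ₐ[ℂ] B) : Prop :=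
  ∀ a : A, ΔB (π a) = MinTensor.map π π (ΔA a)

/-! ## Inductive limits of sequences of unital C*-algebras -/

section InductiveLimit

variable {A : ℕ → Type u} [∀ n, CStarAlgebra (A n)]

/-- The star-algebra of sequences `(a n)` with `a n ∈ A n` that are eventually coherent:
`φ n m (a n) = a m` whenever `n ≤ m` and `n` is large. -/
def eventuallyCoherent (φ : ∀ n m, n ≤ m → A n →⋆ₐ[ℂ] A m) : StarSubalgebra ℂ (∀ n, A n) where
  carrier := {a | ∃ N, ∀ n m (h : n ≤ m), N ≤ n → φ n m h (a n) = a m}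
  mul_mem' := by
    rintro a b ⟨N, hN⟩ ⟨M, hM⟩
    refine ⟨max N M, fun n m h hn ↦ ?_⟩
    simp [hN n m h (le_trans (le_max_left _ _) hn), hM n m h (le_trans (le_max_right _ _) hn)]
  add_mem' := by
    rintro a b ⟨N, hN⟩ ⟨M, hM⟩
    refine ⟨max N M, fun n m h hn ↦ ?_⟩
    simp [hN n m h (le_trans (le_max_left _ _) hn), hM n m h (le_trans (le_max_right _ _) hn)]
  algebraMap_mem' c := ⟨0, fun n m h _ ↦ by
    simpa only [Pi.algebraMap_apply] using AlgHomClass.commutes (φ n m h) c⟩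
  star_mem' := by
    rintro a ⟨N, hN⟩
    refine ⟨N, fun n m h hn ↦ ?_⟩
    simp [map_star, hN n m h hn]

variable (φ : ∀ n m, n ≤ m → A n →⋆ₐ[ℂ] A m)

/-- The seminorm `lim ‖a n‖` of an eventually coherent sequence. -/
def limNorm (a : eventuallyCoherent φ) : ℝ := Filter.limsup (fun n ↦ ‖a.1 n‖) Filter.atTop

open Filter Topology in
/-- For an eventually coherent sequence the norms are eventually decreasing, hence the
limit of `‖a n‖` exists. -/
theorem tendsto_limNorm (a : eventuallyCoherent φ) :
    Tendsto (fun n ↦ ‖a.1 n‖) atTop (𝓝 (limNorm φ a)) := by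
  obtain ⟨N, hN⟩ := a.2
  have hanti : Antitone fun n ↦ ‖a.1 (n + N)‖ := by
    intro n m h
    have := hN (n + N) (m + N) (by omega) (by omega)
    simp only [← this]
    exact NonUnitalStarAlgHom.norm_apply_le _ _
  have h := tendsto_atTop_ciInf hanti ⟨0, by rintro _ ⟨n, rfl⟩; exact norm_nonneg _⟩
  rw [tendsto_add_atTop_iff_nat (f := fun n ↦ ‖a.1 n‖)] at h
  rw [limNorm, h.limsup_eq]
  exact h

/-- The limit seminorm is a C*-seminorm. -/
def limSeminorm : CStarSeminorm (eventuallyCoherent φ) where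
  toSeminorm := Seminorm.of (limNorm φ)
    (fun a b ↦ le_of_tendsto_of_tendsto' (tendsto_limNorm φ (a + b))
      ((tendsto_limNorm φ a).add (tendsto_limNorm φ b)) fun n ↦ norm_add_le (a.1 n) (b.1 n))
    (fun c a ↦ tendsto_nhds_unique (tendsto_limNorm φ (c • a)) (by
      simpa [norm_smul] using (tendsto_limNorm φ a).const_mul ‖c‖))
  mul_le' a b := le_of_tendsto_of_tendsto' (tendsto_limNorm φ (a * b))
      ((tendsto_limNorm φ a).mul (tendsto_limNorm φ b)) fun n ↦ norm_mul_le (a.1 n) (b.1 n)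
  star_mul_self' a := tendsto_nhds_unique (tendsto_limNorm φ (star a * a)) (by
      have h := (tendsto_limNorm φ a).mul (tendsto_limNorm φ a)
      simp only [← CStarRing.norm_star_mul_self] at h
      exact h)

/-- The C*-algebraic inductive limit of the sequence `(A n)` with connecting homomorphisms
`φ n m : A n → A m`: the Hausdorff completion of the algebra of eventually coherent sequences
with respect to the seminorm `lim ‖a n‖` (equivalently, of the algebraic inductive limit). -/
abbrev CStarLimit : Type u := (limSeminorm φ).Compl

variable (hφ : ∀ n m k (hnm : n ≤ m) (hmk : m ≤ k) (a : A n),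
  φ m k hmk (φ n m hnm a) = φ n k (hnm.trans hmk) a)

/-- The sequence `(φ n m a)` for `m ≥ n`, continued by zero for `m < n`. -/
def cohSeq (n : ℕ) (a : A n) : eventuallyCoherent φ :=
  ⟨fun m ↦ if h : n ≤ m then φ n m h a else 0, n, fun m k h hn ↦ by
    simp only [hn, hn.trans h, dite_true, hφ]⟩

theorem of_eq_of_eventually {a b : eventuallyCoherent φ} {N : ℕ} (h : ∀ n, N ≤ n → a.1 n = b.1 n) :
    (limSeminorm φ).of a = (limSeminorm φ).of b := by
  rw [← sub_eq_zero, ← map_sub, ← norm_eq_zero, CStarSeminorm.norm_of]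
  refine tendsto_nhds_unique (tendsto_limNorm φ (a - b)) ?_
  refine tendsto_const_nhds.congr' ?_
  filter_upwards [Filter.eventually_ge_atTop N] with n hn
  simp [h n hn]

/-- The canonical unital star-homomorphism of `A n` into the inductive limit, which sends `a` to
the class of the coherent sequence `(φ n m a)`, `m ≥ n`. -/
def toCStarLimit (n : ℕ) : A n →⋆ₐ[ℂ] CStarLimit φ where
  toFun a := (limSeminorm φ).of (cohSeq φ hφ n a)
  map_one' := by
    rw [← map_one (limSeminorm φ).of]
    exact of_eq_of_eventually φ (N := n) fun m hm ↦ by simp [cohSeq, hm]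
  map_mul' a b := by
    rw [← map_mul]
    exact of_eq_of_eventually φ (N := n) fun m hm ↦ by simp [cohSeq, hm]
  map_zero' := by
    rw [← map_zero (limSeminorm φ).of]
    exact of_eq_of_eventually φ (N := n) fun m hm ↦ by simp [cohSeq]
  map_add' a b := by
    rw [← map_add]
    exact of_eq_of_eventually φ (N := n) fun m hm ↦ by simp [cohSeq, hm]
  commutes' c := by
    rw [← AlgHomClass.commutes (limSeminorm φ).of c]
    exact of_eq_of_eventually φ (N := n) fun m hm ↦ by
      simpa [cohSeq, hm] using AlgHomClass.commutes (φ n m hm) c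
  map_star' a := by
    rw [← map_star]
    exact of_eq_of_eventually φ (N := n) fun m hm ↦ by simp [cohSeq, hm, map_star]

end InductiveLimit

end

/-! The images of the `G n` have dense union in the inductive limit, and star-homomorphisms of
C*-algebras are contractive. Hence a homomorphism out of the limit is the same thing as a compatible
family of homomorphisms on the stages (`CStarLimit.lift`, `CStarLimit.hom_ext`), and a closed
condition need only be checked on the stages (`CStarLimit.induction`).

With ι n the canonical maps, the family (ι n ⊗ ι n) ∘ Δ n is compatible because the connecting maps
are morphisms and ⊗ is functorial; it induces the unique coproduct. Coassociativity is a closed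
condition, and on the image of each stage it follows from naturality of the associator
(`MinTensor.AssocRel.map`). For the cancellation properties, ι n ⊗ ι n maps the dense span of stage
n into the span of the limit, and the images of the tensor squares of the stages have dense union,
since two elements from different stages can be pushed to a common one
(`CStarLimit.dense_of_map_mem_closure`). The universal property is that of the C*-limit; the induced
map intertwines the coproducts because it does so on every stage. -/

theorem StarAlgHom.continuous_of_cstarAlgebra {A : Type u} {B : Type v} [CStarAlgebra A]
    [CStarAlgebra B] (f : A →⋆ₐ[ℂ] B) : Continuous f :=
  AddMonoidHomClass.continuous_of_bound f 1 fun x ↦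
    (NonUnitalStarAlgHom.norm_apply_le f x).trans (one_mul _).ge

/-! ### Inductive limits of C*-algebras: density of the stages and the universal property -/

section InductiveLimit

variable {A : ℕ → Type u} [∀ n, CStarAlgebra (A n)]
  (φ : ∀ n m, n ≤ m → A n →⋆ₐ[ℂ] A m)
  (hφ : ∀ n m k (hnm : n ≤ m) (hmk : m ≤ k) (a : A n),
    φ m k hmk (φ n m hnm a) = φ n k (hnm.trans hmk) a)

theorem toCStarLimit_apply (n : ℕ) (a : A n) :
    toCStarLimit φ hφ n a = (limSeminorm φ).of (cohSeq φ hφ n a) := rfl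

/-- The two representing sequences may differ before stage `m`, where one is padded by zeros, but
the limit seminorm sees only tails. -/
theorem toCStarLimit_comp (n m : ℕ) (h : n ≤ m) (a : A n) :
    toCStarLimit φ hφ m (φ n m h a) = toCStarLimit φ hφ n a :=
  of_eq_of_eventually φ (N := m) fun k hk ↦ by simp [cohSeq, hk, h.trans hk, hφ]

/-- From the stage where coherence begins, the sequence is determined by its entry there. So the
images of the `A n` already exhaust the dense image of the coherent sequences. -/
theorem exists_of_eq_toCStarLimit (a : eventuallyCoherent φ) :
    ∃ N, (limSeminorm φ).of a = toCStarLimit φ hφ N (a.1 N) := by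
  obtain ⟨N, hN⟩ := a.2
  exact ⟨N, of_eq_of_eventually φ (N := N) fun m hm ↦ by simp [cohSeq, hm, hN N m hm le_rfl]⟩

/-- A closed property which holds on the images of all the `A n` holds on the inductive limit. -/
theorem CStarLimit.induction {P : CStarLimit φ → Prop} (x : CStarLimit φ)
    (hc : IsClosed {x | P x}) (h : ∀ n (a : A n), P (toCStarLimit φ hφ n a)) : P x := by
  refine (limSeminorm φ).induction x hc fun a ↦ ?_
  obtain ⟨N, hN⟩ := exists_of_eq_toCStarLimit φ hφ a
  change P ((limSeminorm φ).of a)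
  rw [hN]
  exact h N (a.1 N)

theorem CStarLimit.hom_ext {D : Type u} [CStarAlgebra D] {f g : CStarLimit φ →⋆ₐ[ℂ] D}
    (h : ∀ n (a : A n), f (toCStarLimit φ hφ n a) = g (toCStarLimit φ hφ n a)) : f = g :=
  StarAlgHom.ext fun x ↦ CStarLimit.induction φ hφ x
    (isClosed_eq (StarAlgHom.continuous_of_cstarAlgebra f)
      (StarAlgHom.continuous_of_cstarAlgebra g)) h

include hφ in
theorem CStarLimit.separableSpace (hA : ∀ n, TopologicalSpace.SeparableSpace (A n)) :
    TopologicalSpace.SeparableSpace (CStarLimit φ) := by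
  have hs : TopologicalSpace.IsSeparable (⋃ n, Set.range (toCStarLimit φ hφ n)) :=
    .iUnion fun n ↦ TopologicalSpace.isSeparable_range
      (StarAlgHom.continuous_of_cstarAlgebra (toCStarLimit φ hφ n))
  refine TopologicalSpace.isSeparable_univ_iff.1 (hs.closure.mono fun x _ ↦ ?_)
  exact CStarLimit.induction φ hφ (P := (· ∈ closure _)) x isClosed_closure fun n a ↦
    subset_closure (Set.mem_iUnion.2 ⟨n, a, rfl⟩)

section Lift

variable {D : Type u} [CStarAlgebra D] (f : ∀ n, A n →⋆ₐ[ℂ] D)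
  (hf : ∀ n m (h : n ≤ m) (a : A n), f m (φ n m h a) = f n a)

/-- The eventual value of `f n (a n)` for an eventually coherent sequence `a`. -/
noncomputable def eventualValue (a : eventuallyCoherent φ) : D := f a.2.choose (a.1 a.2.choose)

-- Past the stage where coherence begins, compatibility of `f` keeps the value constant, so the
-- stage picked by `eventualValue` is immaterial.
include hf in
theorem eventually_eq_eventualValue (a : eventuallyCoherent φ) :
    ∀ᶠ n in Filter.atTop, f n (a.1 n) = eventualValue φ f a := by
  filter_upwards [Filter.eventually_ge_atTop a.2.choose] with n hn
  rw [eventualValue, ← a.2.choose_spec _ n hn le_rfl, hf]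

/-- The star-homomorphism on eventually coherent sequences given by a compatible family. -/
noncomputable def eventualValueHom : eventuallyCoherent φ →⋆ₐ[ℂ] D where
  toFun := eventualValue φ f
  map_one' := by
    obtain ⟨n, h⟩ := (eventually_eq_eventualValue φ f hf 1).exists
    rw [← h]; exact map_one (f n)
  map_mul' a b := by
    -- Finitely many elements are involved, so a single stage computes all their values, and there
    -- `f n` is multiplicative.
    obtain ⟨n, h, ha, hb⟩ := ((eventually_eq_eventualValue φ f hf (a * b)).and
      ((eventually_eq_eventualValue φ f hf a).and (eventually_eq_eventualValue φ f hf b))).exists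
    rw [← h, ← ha, ← hb]; exact map_mul (f n) _ _
  map_zero' := by
    obtain ⟨n, h⟩ := (eventually_eq_eventualValue φ f hf 0).exists
    rw [← h]; exact map_zero (f n)
  map_add' a b := by
    obtain ⟨n, h, ha, hb⟩ := ((eventually_eq_eventualValue φ f hf (a + b)).and
      ((eventually_eq_eventualValue φ f hf a).and (eventually_eq_eventualValue φ f hf b))).exists
    rw [← h, ← ha, ← hb]; exact map_add (f n) _ _
  commutes' c := by
    obtain ⟨n, h⟩ := (eventually_eq_eventualValue φ f hf (algebraMap ℂ _ c)).exists
    rw [← h]; exact AlgHomClass.commutes (f n) c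
  map_star' a := by
    obtain ⟨n, h, ha⟩ := ((eventually_eq_eventualValue φ f hf (star a)).and
      (eventually_eq_eventualValue φ f hf a)).exists
    rw [← h, ← ha]; exact map_star (f n) _

/-- Contractivity of `f n` bounds the eventual value by `‖a n‖` for all large `n`; the bound passes
to the limit. -/
theorem norm_eventualValueHom_le (a : eventuallyCoherent φ) :
    ‖eventualValueHom φ f hf a‖ ≤ (limSeminorm φ).toSeminorm a := by
  refine ge_of_tendsto (tendsto_limNorm φ a) ?_
  filter_upwards [eventually_eq_eventualValue φ f hf a] with n hn
  change ‖eventualValue φ f a‖ ≤ _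
  rw [← hn]
  exact NonUnitalStarAlgHom.norm_apply_le (f n) _

/-- The universal property of the inductive limit: the star-homomorphism induced by a
compatible family of star-homomorphisms. -/
noncomputable def CStarLimit.lift : CStarLimit φ →⋆ₐ[ℂ] D :=
  (limSeminorm φ).lift (eventualValueHom φ f hf) (norm_eventualValueHom_le φ f hf)

theorem CStarLimit.lift_toCStarLimit (n : ℕ) (a : A n) :
    CStarLimit.lift φ f hf (toCStarLimit φ hφ n a) = f n a := by
  rw [toCStarLimit_apply, CStarLimit.lift, CStarSeminorm.lift_of]
  -- The stage must also lie at or beyond `n`, since `cohSeq` is zero before it.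
  obtain ⟨m, hm, hnm⟩ := ((eventually_eq_eventualValue φ f hf (cohSeq φ hφ n a)).and
    (Filter.eventually_ge_atTop n)).exists
  change eventualValue φ f _ = _
  rw [← hm]
  simp [cohSeq, hnm, hf]

end Lift

end InductiveLimit

/-! ### Functoriality and density in the minimal tensor product -/

namespace MinTensor

variable {A B C A' B' C' A'' B'' : Type u} [CStarAlgebra A] [CStarAlgebra B] [CStarAlgebra C]
  [CStarAlgebra A'] [CStarAlgebra B'] [CStarAlgebra C'] [CStarAlgebra A''] [CStarAlgebra B'']

theorem map_of (f : A →⋆ₐ[ℂ] A') (g : B →⋆ₐ[ℂ] B') (t : A ⊗[ℂ] B) :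
    map f g ((spatialSeminorm A B).of t) = (spatialSeminorm A' B').of (algTensorMap f g t) := by
  rw [map, CStarSeminorm.lift_of]; rfl

theorem tmul_add (a : A) (b b' : B) : tmul a (b + b') = tmul a b + tmul a b' := by
  simp [tmul, TensorProduct.tmul_add]

theorem add_tmul (a a' : A) (b : B) : tmul (a + a') b = tmul a b + tmul a' b := by
  simp [tmul, TensorProduct.add_tmul]

theorem tmul_smul (c : ℂ) (a : A) (b : B) : tmul a (c • b) = c • tmul a b := by
  rw [tmul, TensorProduct.tmul_smul, map_smul]; rfl

theorem smul_tmul (c : ℂ) (a : A) (b : B) : tmul (c • a) b = c • tmul a b := by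
  rw [tmul, ← TensorProduct.smul_tmul', map_smul]; rfl

/-- This gives continuity in each factor separately, which lets density arguments treat one factor
at a time. -/
theorem norm_tmul_le (a : A) (b : B) : ‖tmul a b‖ ≤ ‖a‖ * ‖b‖ := by
  rw [tmul, CStarSeminorm.norm_of, spatialSeminorm_apply]
  refine spatialNorm_le (by positivity) fun π σ ↦ ?_
  rw [HilbertRep.tensor_tmul]
  refine (TensorProduct.norm_mapL_le _ _).trans ?_
  gcongr <;> exact norm_rep_le _ _

theorem continuous_tmul_left (b : B) : Continuous fun a : A ↦ tmul a b :=
  (LinearMap.mkContinuous (σ := RingHom.id ℂ)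
    { toFun := fun a : A ↦ tmul a b
      map_add' := fun a a' ↦ add_tmul a a' b
      map_smul' := fun c a ↦ smul_tmul c a b } ‖b‖
    fun a ↦ (norm_tmul_le a b).trans (mul_comm _ _).le).continuous

theorem continuous_tmul_right (a : A) : Continuous fun b : B ↦ tmul a b :=
  (LinearMap.mkContinuous (σ := RingHom.id ℂ)
    { toFun := fun b : B ↦ tmul a b
      map_add' := fun b b' ↦ tmul_add a b b'
      map_smul' := fun c b ↦ tmul_smul c a b } ‖a‖
    fun b ↦ norm_tmul_le a b).continuous

/-- A closed subspace containing the elementary tensors is everything. -/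
theorem mem_of_tmul_mem {V : Submodule ℂ (MinTensor A B)}
    (hV : IsClosed (V : Set (MinTensor A B))) (h : ∀ a b, tmul a b ∈ V) (x : MinTensor A B) :
    x ∈ V := by
  refine (spatialSeminorm A B).induction (P := (· ∈ V)) x hV fun t ↦ ?_
  change (spatialSeminorm A B).of t ∈ V
  induction t with
  | zero => rw [map_zero]; exact V.zero_mem
  | add s t hs ht => rw [map_add]; exact V.add_mem hs ht
  | tmul a b => exact h a b

theorem hom_ext {D : Type u} [CStarAlgebra D] {f g : MinTensor A B →⋆ₐ[ℂ] D}
    (h : ∀ a b, f (tmul a b) = g (tmul a b)) : f = g :=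
  StarAlgHom.ext fun x ↦ mem_of_tmul_mem
    (V := LinearMap.eqLocus (f : MinTensor A B →ₗ[ℂ] D) (g : MinTensor A B →ₗ[ℂ] D))
    (isClosed_eq (StarAlgHom.continuous_of_cstarAlgebra f)
      (StarAlgHom.continuous_of_cstarAlgebra g)) h x

theorem map_comp (f' : A' →⋆ₐ[ℂ] A'') (f : A →⋆ₐ[ℂ] A') (g' : B' →⋆ₐ[ℂ] B'')
    (g : B →⋆ₐ[ℂ] B') : map (f'.comp f) (g'.comp g) = (map f' g').comp (map f g) :=
  hom_ext fun a b ↦ by simp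

/-- A commuting square in each factor gives one on the tensor product. It serves to move `f ⊗ f`
past `Δ ⊗ id` and `id ⊗ Δ`. -/
theorem map_map_of_comp_eq {D E : Type u} [CStarAlgebra D] [CStarAlgebra E]
    {f' : A' →⋆ₐ[ℂ] A''} {f : A →⋆ₐ[ℂ] A'} {g' : B' →⋆ₐ[ℂ] B''} {g : B →⋆ₐ[ℂ] B'}
    {k' : D →⋆ₐ[ℂ] A''} {k : A →⋆ₐ[ℂ] D} {l' : E →⋆ₐ[ℂ] B''} {l : B →⋆ₐ[ℂ] E}
    (hf : f'.comp f = k'.comp k) (hg : g'.comp g = l'.comp l) (x : MinTensor A B) :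
    map f' g' (map f g x) = map k' l' (map k l x) := by
  rw [← StarAlgHom.comp_apply, ← StarAlgHom.comp_apply, ← map_comp, ← map_comp, hf, hg]

/-- The associativity relation is natural in the three factors. -/
theorem AssocRel.map {x : MinTensor (MinTensor A B) C} {y : MinTensor A (MinTensor B C)}
    (h : AssocRel x y) (f : A →⋆ₐ[ℂ] A') (g : B →⋆ₐ[ℂ] B') (k : C →⋆ₐ[ℂ] C') :
    AssocRel (MinTensor.map (MinTensor.map f g) k x) (MinTensor.map f (MinTensor.map g k) y) := by
  have hcont : Continuous fun z : MinTensor (MinTensor A B) C × MinTensor A (MinTensor B C) ↦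
      (MinTensor.map (MinTensor.map f g) k z.1, MinTensor.map f (MinTensor.map g k) z.2) :=
    ((StarAlgHom.continuous_of_cstarAlgebra (MinTensor.map (MinTensor.map f g) k)).comp
      continuous_fst).prodMk
      ((StarAlgHom.continuous_of_cstarAlgebra (MinTensor.map f (MinTensor.map g k))).comp
      continuous_snd)
  -- The relation is the closure of a graph, so by continuity it is enough to treat algebraic
  -- tensors.
  refine map_mem_closure (x := (x, y)) hcont h ?_
  rintro _ ⟨t, rfl⟩
  refine ⟨algTensorMap (algTensorMap f g) k t, Prod.ext ?_ ?_⟩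
  · change ofLeft A' B' C' (algTensorMap (algTensorMap f g) k t)
      = MinTensor.map (MinTensor.map f g) k (ofLeft A B C t)
    rw [ofLeft, ofLeft, StarAlgHom.comp_apply, StarAlgHom.comp_apply, map_of]
    congr 1
    induction t with
    | zero => simp only [map_zero]
    | add s t hs ht => simp only [map_add, hs, ht]
    | tmul s c => simp only [algTensorMap_tmul, map_of]; rfl
  · change ofRight A' B' C' (TensorProduct.assoc ℂ A' B' C' (algTensorMap (algTensorMap f g) k t))
      = MinTensor.map f (MinTensor.map g k) (ofRight A B C (TensorProduct.assoc ℂ A B C t))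
    rw [ofRight, ofRight, StarAlgHom.comp_apply, StarAlgHom.comp_apply, map_of]
    congr 1
    induction t with
    | zero => simp only [map_zero]
    | add s t hs ht => simp only [map_add, hs, ht]
    -- The associator is computed on pure triples only, so here the left factor has to be decomposed
    -- too.
    | tmul s c =>
      induction s with
      | zero => simp only [TensorProduct.zero_tmul, map_zero]
      | add s s' hs hs' => simp only [TensorProduct.add_tmul, map_add, hs, hs']
      | tmul a b => simp only [algTensorMap_tmul, TensorProduct.assoc_tmul, map_of]; rfl

end MinTensor

/-! ### Passage of the quantum group axioms to the limit -/

/-- A morphism carries the coassociativity of the source to the coassociativity of the target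
on its range. -/
theorem IsCQGMorphism.assocRel {A B : Type u} [CStarAlgebra A] [CStarAlgebra B]
    {ΔA : A →⋆ₐ[ℂ] MinTensor A A} {ΔB : B →⋆ₐ[ℂ] MinTensor B B} {f : A →⋆ₐ[ℂ] B}
    (hf : IsCQGMorphism ΔA ΔB f) {a : A}
    (h : MinTensor.AssocRel (MinTensor.map ΔA (StarAlgHom.id ℂ A) (ΔA a))
      (MinTensor.map (StarAlgHom.id ℂ A) ΔA (ΔA a))) :
    MinTensor.AssocRel (MinTensor.map ΔB (StarAlgHom.id ℂ B) (ΔB (f a)))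
      (MinTensor.map (StarAlgHom.id ℂ B) ΔB (ΔB (f a))) := by
  have hf' : ΔB.comp f = (MinTensor.map f f).comp ΔA := StarAlgHom.ext hf
  have hid : (StarAlgHom.id ℂ B).comp f = f.comp (StarAlgHom.id ℂ A) := StarAlgHom.ext fun _ ↦ rfl
  -- Both iterated coproducts of `f a` become images under `f ⊗ f ⊗ f` of those of `a`.
  rw [hf, MinTensor.map_map_of_comp_eq hf' hid, MinTensor.map_map_of_comp_eq hid hf']
  exact h.map f f f

section Limit

variable {G : ℕ → Type u} [∀ n, CStarAlgebra (G n)] {Δ : ∀ n, G n →⋆ₐ[ℂ] MinTensor (G n) (G n)}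
  {π : ∀ n m, n ≤ m → G n →⋆ₐ[ℂ] G m}
  (hπ : ∀ n m k (hnm : n ≤ m) (hmk : m ≤ k) (a : G n),
    π m k hmk (π n m hnm a) = π n k (hnm.trans hmk) a)

/-- A subspace of the tensor square of the inductive limit is dense as soon as its closure
contains the images of the tensor squares of the `G n`. -/
theorem CStarLimit.dense_of_map_mem_closure
    (V : Submodule ℂ (MinTensor (CStarLimit π) (CStarLimit π)))
    (h : ∀ n x, MinTensor.map (toCStarLimit π hπ n) (toCStarLimit π hπ n) x
      ∈ closure (V : Set (MinTensor (CStarLimit π) (CStarLimit π)))) :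
    Dense (V : Set (MinTensor (CStarLimit π) (CStarLimit π))) := by
  refine fun z ↦ MinTensor.mem_of_tmul_mem (V := V.topologicalClosure)
    V.isClosed_topologicalClosure (fun x y ↦ ?_) z
  refine CStarLimit.induction π hπ x (P := fun x ↦ MinTensor.tmul x y ∈ V.topologicalClosure)
    (V.isClosed_topologicalClosure.preimage (MinTensor.continuous_tmul_left y)) fun n a ↦ ?_
  refine CStarLimit.induction π hπ y (P := fun y ↦ MinTensor.tmul _ y ∈ V.topologicalClosure)
    (V.isClosed_topologicalClosure.preimage (MinTensor.continuous_tmul_right _)) fun m b ↦ ?_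
  -- The two factors come from different stages; both are moved to stage `max n m`, where they form
  -- one elementary tensor.
  rw [← toCStarLimit_comp π hπ n (max n m) (le_max_left _ _),
    ← toCStarLimit_comp π hπ m (max n m) (le_max_right _ _), ← MinTensor.map_tmul]
  exact h _ _

/-- The cancellation property passes to the inductive limit; `e` is one of the two embeddings of
an algebra in its tensor square. -/
theorem CStarLimit.dense_span_comul_mul
    (Δlim : CStarLimit π →⋆ₐ[ℂ] MinTensor (CStarLimit π) (CStarLimit π))
    (hΔ : ∀ n, IsCQGMorphism (Δ n) Δlim (toCStarLimit π hπ n))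
    (e : ∀ (A : Type u) [CStarAlgebra A], A → MinTensor A A)
    (he : ∀ n b, MinTensor.map (toCStarLimit π hπ n) (toCStarLimit π hπ n) (e (G n) b)
      = e (CStarLimit π) (toCStarLimit π hπ n b))
    (hd : ∀ n, Dense (Submodule.span ℂ {x : MinTensor (G n) (G n) |
      ∃ a b : G n, x = Δ n a * e (G n) b} : Set (MinTensor (G n) (G n)))) :
    Dense (Submodule.span ℂ {x : MinTensor (CStarLimit π) (CStarLimit π) |
      ∃ a b : CStarLimit π, x = Δlim a * e (CStarLimit π) b} :
        Set (MinTensor (CStarLimit π) (CStarLimit π))) := by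
  refine CStarLimit.dense_of_map_mem_closure hπ _ fun n x ↦ ?_
  refine map_mem_closure (StarAlgHom.continuous_of_cstarAlgebra _) (hd n x) fun y hy ↦ ?_
  induction hy using Submodule.span_induction with
  | mem y hy =>
    obtain ⟨a, b, rfl⟩ := hy
    -- The generator `Δ n a * e b` goes to the generator of the limit span built from the images of
    -- `a` and `b`.
    rw [map_mul, he, ← hΔ n a]
    exact Submodule.subset_span ⟨_, _, rfl⟩
  | zero => rw [map_zero]; exact Submodule.zero_mem _
  | add y z _ _ hy hz => rw [map_add]; exact Submodule.add_mem _ hy hz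
  | smul c y _ hy => rw [map_smul]; exact Submodule.smul_mem _ c hy

theorem CStarLimit.isCompactQuantumGroup (hG : ∀ n, IsCompactQuantumGroup (Δ n))
    (Δlim : CStarLimit π →⋆ₐ[ℂ] MinTensor (CStarLimit π) (CStarLimit π))
    (hΔ : ∀ n, IsCQGMorphism (Δ n) Δlim (toCStarLimit π hπ n)) :
    IsCompactQuantumGroup Δlim where
  separable := CStarLimit.separableSpace π hπ fun n ↦ (hG n).separable
  coassoc x := by
    refine CStarLimit.induction π hπ x (P := fun x ↦ MinTensor.AssocRel
      (MinTensor.map Δlim (StarAlgHom.id ℂ _) (Δlim x))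
      (MinTensor.map (StarAlgHom.id ℂ _) Δlim (Δlim x))) ?_ fun n a ↦ (hΔ n).assocRel ((hG n).coassoc a)
    -- `AssocRel` is membership in a closure, and the pair of iterated coproducts depends
    -- continuously on the point.
    exact isClosed_closure.preimage
      (((StarAlgHom.continuous_of_cstarAlgebra (MinTensor.map Δlim (StarAlgHom.id ℂ _))).comp
        (StarAlgHom.continuous_of_cstarAlgebra Δlim)).prodMk
        ((StarAlgHom.continuous_of_cstarAlgebra (MinTensor.map (StarAlgHom.id ℂ _) Δlim)).comp
        (StarAlgHom.continuous_of_cstarAlgebra Δlim)))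
  cancel_left := CStarLimit.dense_span_comul_mul hπ Δlim hΔ
    (fun _ _ b ↦ MinTensor.tmul b 1) (fun n b ↦ by simp) fun n ↦ (hG n).cancel_left
  cancel_right := CStarLimit.dense_span_comul_mul hπ Δlim hΔ
    (fun _ _ b ↦ MinTensor.tmul 1 b) (fun n b ↦ by simp) fun n ↦ (hG n).cancel_right

end Limit

/-! ### The limit coproduct and its universal property -/

theorem lemma1p1
    -- a sequence of compact quantum groups
    (G : ℕ → Type u) [∀ n, CStarAlgebra (G n)]
    (Δ : ∀ n, G n →⋆ₐ[ℂ] MinTensor (G n) (G n))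
    (hG : ∀ n, IsCompactQuantumGroup (Δ n))
    -- with compatible connecting morphisms
    (π : ∀ n m, n ≤ m → G n →⋆ₐ[ℂ] G m)
    (hπΔ : ∀ n m (h : n ≤ m), IsCQGMorphism (Δ n) (Δ m) (π n m h))
    (hπ : ∀ n m k (hnm : n ≤ m) (hmk : m ≤ k) (a : G n),
      π m k hmk (π n m hnm a) = π n k (hnm.trans hmk) a) :
    -- there is exactly one coproduct on the inductive limit that is compatible with all of the
    -- canonical homomorphisms
    (∃! Δlim : CStarLimit π →⋆ₐ[ℂ] MinTensor (CStarLimit π) (CStarLimit π),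
      ∀ n, IsCQGMorphism (Δ n) Δlim (toCStarLimit π hπ n)) ∧
    -- the canonical homomorphisms form a cocone over the system
    (∀ n m (h : n ≤ m) (a : G n),
      toCStarLimit π hπ m (π n m h a) = toCStarLimit π hπ n a) ∧
    -- the inductive limit with this coproduct is a compact quantum group, universal among
    -- the compact quantum groups that receive compatible morphisms
    (∀ Δlim : CStarLimit π →⋆ₐ[ℂ] MinTensor (CStarLimit π) (CStarLimit π),
      (∀ n, IsCQGMorphism (Δ n) Δlim (toCStarLimit π hπ n)) →
      IsCompactQuantumGroup Δlim ∧
      ∀ (B : Type u) [CStarAlgebra B] (ΔB : B →⋆ₐ[ℂ] MinTensor B B),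
        IsCompactQuantumGroup ΔB →
        ∀ ψ : ∀ n, G n →⋆ₐ[ℂ] B,
          (∀ n, IsCQGMorphism (Δ n) ΔB (ψ n)) →
          (∀ n m (h : n ≤ m) (a : G n), ψ m (π n m h a) = ψ n a) →
          ∃! ψlim : CStarLimit π →⋆ₐ[ℂ] B,
            IsCQGMorphism Δlim ΔB ψlim ∧
              ∀ n (a : G n), ψlim (toCStarLimit π hπ n a) = ψ n a) := by
  let ι := toCStarLimit π hπ
  have hι : ∀ n m (h : n ≤ m) (a : G n), ι m (π n m h a) = ι n a := toCStarLimit_comp π hπ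
  refine ⟨?_, hι, fun Δlim hΔ ↦ ⟨CStarLimit.isCompactQuantumGroup hπ hG Δlim hΔ, ?_⟩⟩
  -- Compatibility of the family (ι n ⊗ ι n) ∘ Δ n, which then induces the coproduct.
  · have hf : ∀ n m (h : n ≤ m) (a : G n),
        ((MinTensor.map (ι m) (ι m)).comp (Δ m)) (π n m h a)
          = ((MinTensor.map (ι n) (ι n)).comp (Δ n)) a := fun n m h a ↦ by
      have hc : (ι m).comp (π n m h) = ι n := StarAlgHom.ext (hι n m h)
      rw [StarAlgHom.comp_apply, StarAlgHom.comp_apply, hπΔ n m h a, ← StarAlgHom.comp_apply,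
        ← MinTensor.map_comp, hc]
    refine ⟨CStarLimit.lift π _ hf, fun n a ↦ CStarLimit.lift_toCStarLimit π hπ _ hf n a,
      fun Δ' h' ↦ CStarLimit.hom_ext π hπ fun n a ↦ ?_⟩
    rw [CStarLimit.lift_toCStarLimit]
    exact h' n a
  · intro B _ ΔB _ ψ hψΔ hψ
    have hlift : ∀ n a, CStarLimit.lift π ψ hψ (ι n a) = ψ n a :=
      CStarLimit.lift_toCStarLimit π hπ ψ hψ
    refine ⟨CStarLimit.lift π ψ hψ, ⟨fun x ↦ ?_, hlift⟩,
      fun ψ' h' ↦ CStarLimit.hom_ext π hπ fun n a ↦ (h'.2 n a).trans (hlift n a).symm⟩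
    -- Intertwining is an equality of two homomorphisms out of the limit, so the stages decide it;
    -- there `ψ n` factors as the lift after `ι n`, and so does its tensor square.
    refine DFunLike.congr_fun (CStarLimit.hom_ext π hπ
      (f := ΔB.comp (CStarLimit.lift π ψ hψ))
      (g := (MinTensor.map (CStarLimit.lift π ψ hψ) (CStarLimit.lift π ψ hψ)).comp Δlim)
      fun n a ↦ ?_) x
    have hc : (CStarLimit.lift π ψ hψ).comp (ι n) = ψ n := StarAlgHom.ext (hlift n)
    change ΔB (CStarLimit.lift π ψ hψ (ι n a)) = MinTensor.map _ _ (Δlim (ι n a))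
    rw [hlift, hψΔ n a, hΔ n a, ← hc, MinTensor.map_comp, StarAlgHom.comp_apply]
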